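/- **Model.** Fix $n$ processes. A chromatic input complex $\mathcal I$ is a simplicial complex whose vertices are coloured by processes so that the vertices of each simplex have pairwise distinct colours; the input of a process is its vertex in a chosen simplex of $\mathcal I$. In the bounded iterated immediate snapshot (B-IIS) protocol, process $i$ starts in a state determined by its input, and in each round $k=1,2,\dots$ it writes $\mathrm{encode}_i(s,k)$, where $s$ is its current state, to its entry of a fresh shared array initialised to $\bot$, takes an immediate snapshot $v$ of that array, and moves to the state $\mathrm{next\_state}_i(v,s,k)$. The functions $\mathrm{encode}_i$, $\mathrm{next\_state}_i$ and the initial-state functions are arbitrary, and any processes may crash. In the full-information IIS protocol, a process writes its complete view, and the snapshot it reads becomes its new view. The protocol complex after $r$ rounds on $\mathcal I$ has as vertices the pairs (process, local state) that can occur after $r$ rounds in an execution started from a simplex of $\mathcal I$, and as simplices the nonempty sets of such pairs that can occur together in one execution. Write $\Xi^r(\mathcal I)$ for the protocol complex of the full-information protocol and $\Xi_b^r(\mathcal I)$ for that of the B-IIS protocol. The bit complexity of process $p$ in round $r$ is $\log_2|E_{p,r}|$, where $E_{p,r}$ is the set of values that $p$ can write in round $r$ over all these executions. **Statement.** There is an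 absolute constant $C>0$ such that for every number $n>2$ of processes, every number $r\ge 2$ of rounds, every finite chromatic input complex $\mathcal I$ of dimension $n-1$ (that is, some simplex of $\mathcal I$ contains a vertex of every process), and every B-IIS protocol: if $\Xi_b^r(\mathcal I)\cong\Xi^r(\mathcal I)$ as simplicial complexes, then the bit complexity of every process in round $r$ is at least $C\,r\,n$. In other words, the per-process bit complexity in round $r$ is $\Omega(rn)$. -/

import Mathlib

/-! # Iterated immediate snapshot protocols and their protocol complexes

The processes are the elements of `Fin n`. -/

universe u v w

namespace IIS

/-- The vertices of a simplicial complex: the points that span a singleton face. -/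
def vertices {V : Type u} (K : PreAbstractSimplicialComplex V) : Set V :=
  {x | {x} ∈ K.faces}

/-- Two simplicial complexes are isomorphic: some bijection between their vertex sets is
simplicial in both directions. -/
def Isomorphic {V : Type u} {W : Type v}
    (K : PreAbstractSimplicialComplex V) (L : PreAbstractSimplicialComplex W) : Prop :=
  ∃ f : vertices K ≃ vertices L, ∀ s : Finset (vertices K),
    s.map (Function.Embedding.subtype _) ∈ K.faces ↔
      (s.map f.toEmbedding).map (Function.Embedding.subtype _) ∈ L.faces

/-- A chromatic simplicial complex: each vertex is coloured by a process, and the vertices of a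
simplex have pairwise distinct colours. -/
structure ChromaticComplex (n : ℕ) (V : Type u) extends PreAbstractSimplicialComplex V where
  color : V → Fin n
  color_injOn : ∀ σ ∈ faces, Set.InjOn color (σ : Set V)

/-- What a process reads from a memory layer: for each process, the value in its entry, or
`none` (that is, `⊥`) when nothing has been written there. -/
abbrev Snapshot (n : ℕ) (E : Type u) : Type u := Fin n → Option E

/-- A bounded IIS protocol with inputs in `X`, process states in `S` and memory entries in `E`.
`init i x` is the first state of process `i` on input `x`, `encode i s k` is the value that `i`
writes in round `k` from state `s`, and `nextState i v s k` is its state after it has read the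
snapshot `v` in round `k`. -/
structure Protocol (n : ℕ) (X : Type u) (S : Type v) (E : Type w) where
  init : Fin n → X → S
  encode : Fin n → S → ℕ → E
  nextState : Fin n → Snapshot n E → S → ℕ → S

/-- The states of the full-information protocol: an input, or a snapshot of such states. -/
inductive View (n : ℕ) (X : Type u) : Type u
  | input (x : X) : View n X
  | snap (v : Fin n → Option (View n X)) : View n X

/-- The full-information IIS protocol: a process writes its complete view, and the snapshot that
it reads becomes its new view. -/
def fullInformation (n : ℕ) (X : Type u) : Protocol n X (View n X) (View n X) where
  init _ x := .input x
  encode _ s _ := s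
  nextState _ v _ _ := .snap v

variable {n : ℕ} {V : Type u} {S : Type v} {E : Type w}

/-- A global configuration: the local states of the processes that are still alive. -/
abbrev Config (n : ℕ) (S : Type v) : Type v := Fin n → Option S

/-- The value of process `j` that is visible to process `i` in round `k`, in the immediate
snapshot execution in which the processes in `A` take part, arranged in consecutive blocks by
`block` (the members of a block write together and then read together). Process `i` sees the
values of all processes that take part and whose block is not after its own. -/
def view (P : Protocol n V S E) (k : ℕ) (c : Config n S) (A : Finset (Fin n))
    (block : Fin n → ℕ) (i : Fin n) : Snapshot n E := fun j =>
  if j ∈ A ∧ block j ≤ block i then (c j).map (fun s => P.encode j s k) else none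

/-- The configuration after round `k`, when the processes in `A` that are alive in `c` take part
in that round, arranged in blocks by `block`, and all other processes have crashed. -/
def step (P : Protocol n V S E) (k : ℕ) (c : Config n S) (A : Finset (Fin n))
    (block : Fin n → ℕ) : Config n S := fun i =>
  if i ∈ A then (c i).map (fun s => P.nextState i (view P k c A block i) s k) else none

/-- `Reachable P I k c`: the configuration `c` can occur after `k` rounds of the protocol `P`
in an execution whose inputs are given by a simplex of `I`. -/
inductive Reachable (P : Protocol n V S E) (I : ChromaticComplex n V) : ℕ → Config n S → Prop
  | start (σ : Finset V) (hσ : σ ∈ I.faces) (c : Config n S)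
      (hc : ∀ i s, c i = some s ↔ ∃ x ∈ σ, I.color x = i ∧ P.init i x = s) :
      Reachable P I 0 c
  | round (k : ℕ) (c : Config n S) (h : Reachable P I k c) (A : Finset (Fin n))
      (block : Fin n → ℕ) :
      Reachable P I (k + 1) (step P (k + 1) c A block)

/-- The protocol complex of `P` after `r` rounds on the input complex `I`. Its vertices are pairs
of a process and a local state; a nonempty set of them is a simplex when they occur together in
a configuration that can be reached in `r` rounds. -/
def protocolComplex (P : Protocol n V S E) (I : ChromaticComplex n V) (r : ℕ) :
    PreAbstractSimplicialComplex (Fin n × S) where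
  faces := {τ | τ.Nonempty ∧ ∃ c, Reachable P I r c ∧ ∀ q ∈ τ, c q.1 = some q.2}
  isRelLowerSet_faces := by
    rintro τ ⟨hτ, c, hc, h⟩
    exact ⟨hτ, fun t hts ht => ⟨ht, c, hc, fun q hq => h q (hts hq)⟩⟩

/-- The encoding set of process `p` in round `r`: the values that `p` can write in round `r`, from
its states after `r - 1` rounds, in executions of `P` on the input complex `I`. -/
def encodingSet (P : Protocol n V S E) (I : ChromaticComplex n V) (r : ℕ) (p : Fin n) : Set E :=
  {e | ∃ c s, Reachable P I (r - 1) c ∧ c p = some s ∧ e = P.encode p s r}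

/-- The bit complexity of process `p` in round `r`: the binary logarithm of the size of its
encoding set. -/
noncomputable def bitComplexity (P : Protocol n V S E) (I : ChromaticComplex n V) (r : ℕ)
    (p : Fin n) : ℝ :=
  Real.logb 2 ((encodingSet P I r p).ncard : ℝ)

end IIS

/-! # A lower bound on the bit complexity of bounded IIS protocols

The local state of a process in an arbitrary protocol `P` is a function of its full-information
view (`run_eq_of_fullInformation_eq`). This yields a surjection from the vertices of the
full-information protocol complex onto the vertices of the protocol complex of `P`. Both vertex
sets are finite, and an isomorphism makes them equinumerous, so the surjection is a bijection: the
local state in `P` after `r` rounds determines the full-information view after `r` rounds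
(`fullInformation_eq_of_run_eq`).

Now let `q ≠ p`, start from a simplex with a vertex of every process, and consider the executions
in which `q` goes first and alone in each of the first `r - 1` rounds, followed by `p` together
with an arbitrary set of other processes, followed by the rest. The `2 ^ ((n - 2) * (r - 1))`
choices of these sets give pairwise distinct full-information views of `p`, while `q` is always
in the same state. If two of them made `p` write the same value in round `r`, then `q`, reading
exactly `p` and itself in that round, would end in the same state of `P` with two different
full-information views. Hence `p` has at least `2 ^ ((n - 2) * (r - 1))` values to write in round
`r`, and `(n - 2) * (r - 1) ≥ r * n / 6`. -/

namespace IIS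

variable {n : ℕ} {V : Type u} {S : Type v} {E : Type w}

/-! ### Executions as explicit data -/

/-- A schedule: for each round, the participating processes and their arrangement in blocks.
Entry `k` governs round `k + 1`. -/
abbrev Schedule (n : ℕ) : Type := ℕ → Finset (Fin n) × (Fin n → ℕ)

/-- The initial configuration on the input simplex `σ`. -/
noncomputable def startConfig (P : Protocol n V S E) (I : ChromaticComplex n V) (σ : Finset V) :
    Config n S :=
  open Classical in
  fun i => if h : ∃ x ∈ σ, I.color x = i then some (P.init i h.choose) else none

/-- The configuration that the schedule `sch` produces from the input simplex `σ` in the given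
number of rounds. -/
noncomputable def run (P : Protocol n V S E) (I : ChromaticComplex n V) (σ : Finset V)
    (sch : Schedule n) : ℕ → Config n S
  | 0 => startConfig P I σ
  | k + 1 => step P (k + 1) (run P I σ sch k) (sch k).1 (sch k).2

theorem startConfig_eq_some_iff (P : Protocol n V S E) (I : ChromaticComplex n V) {σ : Finset V}
    (hσ : σ ∈ I.faces) (i : Fin n) (s : S) :
    startConfig P I σ i = some s ↔ ∃ x ∈ σ, I.color x = i ∧ P.init i x = s := by
  unfold startConfig
  split_ifs with h
  · obtain ⟨hx, hc⟩ := h.choose_spec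
    constructor
    · intro hs
      exact ⟨_, hx, hc, Option.some.inj hs⟩
    · rintro ⟨y, hy, hyc, rfl⟩
      rw [I.color_injOn σ hσ hy hx (hyc.trans hc.symm)]
  · refine iff_of_false not_false ?_
    rintro ⟨x, hx, hc, -⟩
    exact h ⟨x, hx, hc⟩

theorem run_congr (P : Protocol n V S E) (I : ChromaticComplex n V) (σ : Finset V)
    {sch sch' : Schedule n} {k : ℕ} (h : ∀ t < k, sch t = sch' t) :
    run P I σ sch k = run P I σ sch' k := by
  induction k with
  | zero => rfl
  | succ k ih =>
    simp only [run, h k k.lt_succ_self, ih fun t ht => h t (ht.trans k.lt_succ_self)]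

theorem reachable_run (P : Protocol n V S E) (I : ChromaticComplex n V) {σ : Finset V}
    (hσ : σ ∈ I.faces) (sch : Schedule n) (k : ℕ) : Reachable P I k (run P I σ sch k) := by
  induction k with
  | zero => exact .start σ hσ _ (startConfig_eq_some_iff P I hσ)
  | succ k ih => exact .round k _ ih _ _

theorem Reachable.exists_run {P : Protocol n V S E} {I : ChromaticComplex n V} {k : ℕ}
    {c : Config n S} (h : Reachable P I k c) :
    ∃ σ ∈ I.faces, ∃ sch : Schedule n, c = run P I σ sch k := by
  induction h with
  | start σ hσ c hc =>
    refine ⟨σ, hσ, fun _ => (∅, 0), funext fun i => Option.ext fun s => ?_⟩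
    exact (hc i s).trans (startConfig_eq_some_iff P I hσ i s).symm
  | round k c _ A block ih =>
    obtain ⟨σ, hσ, sch, rfl⟩ := ih
    refine ⟨σ, hσ, Function.update sch k (A, block), ?_⟩
    have : run P I σ (Function.update sch k (A, block)) k = run P I σ sch k :=
      run_congr P I σ fun t ht => Function.update_of_ne ht.ne _ _
    simp [run, this]

/-! ### Finiteness -/

/-- Only finitely many configurations are reachable: although there are infinitely many block
functions, a round depends only on the comparisons between the blocks. -/
theorem finite_reachable (P : Protocol n V S E) {I : ChromaticComplex n V}
    (hI : I.faces.Finite) (k : ℕ) : {c | Reachable P I k c}.Finite := by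
  classical
  induction k with
  | zero =>
    refine (hI.image (startConfig P I)).subset fun c hc => ?_
    obtain ⟨σ, hσ, sch, rfl⟩ := hc.exists_run
    exact ⟨σ, hσ, rfl⟩
  | succ k ih =>
    let g : Finset (Fin n) × (Fin n → Fin n → Prop) → Config n S → Config n S :=
      fun a c i => if i ∈ a.1 then (c i).map (fun s => P.nextState i
        (fun j => if j ∈ a.1 ∧ a.2 i j then (c j).map (fun s => P.encode j s (k + 1)) else none)
        s (k + 1)) else none
    refine (Set.Finite.image2 g (Set.finite_univ) ih).subset fun c hc => ?_
    cases hc with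
    | round k c h A block =>
      refine ⟨(A, fun i j => block j ≤ block i), Set.mem_univ _, c, h, ?_⟩
      funext i
      simp only [g, step]
      congr!
      simp only [view]
      congr!

theorem mem_vertices_protocolComplex {P : Protocol n V S E} {I : ChromaticComplex n V} {r : ℕ}
    {x : Fin n × S} :
    x ∈ vertices (protocolComplex P I r) ↔ ∃ c, Reachable P I r c ∧ c x.1 = some x.2 := by
  change _ ∧ (∃ c, Reachable P I r c ∧ ∀ q ∈ ({x} : Finset (Fin n × S)), c q.1 = some q.2) ↔ _
  simp only [Finset.singleton_nonempty, true_and, Finset.mem_singleton, forall_eq]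

theorem finite_vertices_protocolComplex (P : Protocol n V S E) {I : ChromaticComplex n V}
    (hI : I.faces.Finite) (r : ℕ) : (vertices (protocolComplex P I r)).Finite := by
  refine ((finite_reachable P hI r).biUnion (t := fun c => {x : Fin n × S | c x.1 = some x.2})
    fun c _ => ?_).subset fun x hx => ?_
  · refine Set.Finite.of_finite_image (f := Prod.fst) (Set.toFinite _) ?_
    rintro ⟨i, s⟩ hs ⟨j, t⟩ ht (rfl : i = j)
    exact congrArg _ (Option.some.inj (hs.symm.trans ht))
  · obtain ⟨c, hc, h⟩ := mem_vertices_protocolComplex.1 hx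
    exact Set.mem_biUnion hc h

theorem finite_encodingSet (P : Protocol n V S E) {I : ChromaticComplex n V}
    (hI : I.faces.Finite) (r : ℕ) (p : Fin n) : (encodingSet P I r p).Finite := by
  refine ((finite_vertices_protocolComplex P hI (r - 1)).image
    fun x => P.encode p x.2 r).subset ?_
  rintro e ⟨c, s, hc, hs, rfl⟩
  exact ⟨(p, s), mem_vertices_protocolComplex.2 ⟨c, hc, hs⟩, rfl⟩

/-! ### Local states and full-information views -/

/-- Which processes are alive depends on the input simplex and the schedule only. -/
theorem run_eq_none_iff {S' : Type*} {E' : Type*} (P : Protocol n V S E) (Q : Protocol n V S' E')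
    (I : ChromaticComplex n V) (σ : Finset V) (sch : Schedule n) (k : ℕ) (i : Fin n) :
    run P I σ sch k i = none ↔ run Q I σ sch k i = none := by
  induction k with
  | zero => simp [run, startConfig]
  | succ k ih =>
    simp only [run, step]
    split_ifs <;> simp [ih]

theorem view_fullInformation (k : ℕ) (c : Config n (View n V)) (A : Finset (Fin n))
    (block : Fin n → ℕ) (i j : Fin n) :
    view (fullInformation n V) k c A block i j =
      if j ∈ A ∧ block j ≤ block i then c j else none := by
  simp [view, fullInformation]

/-- If two executions give a process the same view in one round of the full-information protocol,
then it saw the same processes alive, with the same views. -/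
theorem view_eq_of_step_eq {k : ℕ} {c c' : Config n (View n V)} {A A' : Finset (Fin n)}
    {block block' : Fin n → ℕ} {i : Fin n}
    (h : step (fullInformation n V) k c A block i = step (fullInformation n V) k c' A' block' i)
    (h0 : step (fullInformation n V) k c A block i ≠ none) :
    i ∈ A ∧ i ∈ A' ∧ ∀ j, (if j ∈ A ∧ block j ≤ block i then c j else none) =
      if j ∈ A' ∧ block' j ≤ block' i then c' j else none := by
  have h0' := h ▸ h0
  have hA : i ∈ A := by
    by_contra hA
    simp [step, hA] at h0
  have hA' : i ∈ A' := by
    by_contra hA'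
    simp [step, hA'] at h0'
  refine ⟨hA, hA', fun j => ?_⟩
  simp only [step, hA, hA', if_true] at h h0 h0'
  obtain ⟨s, hs⟩ := Option.ne_none_iff_exists'.1 fun hc : c i = none => h0 (by simp [hc])
  obtain ⟨s', hs'⟩ := Option.ne_none_iff_exists'.1 fun hc : c' i = none => h0' (by simp [hc])
  simp only [hs, hs', Option.map_some, Option.some.injEq] at h
  have hv : view (fullInformation n V) k c A block i =
      view (fullInformation n V) k c' A' block' i := View.snap.inj h
  rw [← view_fullInformation k, ← view_fullInformation k, hv]

/-- The state of a process in any protocol is determined by its full-information view. -/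
theorem run_eq_of_fullInformation_eq (P : Protocol n V S E) (I : ChromaticComplex n V)
    {σ σ' : Finset V} {sch sch' : Schedule n} {k : ℕ} {i : Fin n}
    (h : run (fullInformation n V) I σ sch k i = run (fullInformation n V) I σ' sch' k i) :
    run P I σ sch k i = run P I σ' sch' k i := by
  by_cases h0 : run (fullInformation n V) I σ sch k i = none
  · rw [(run_eq_none_iff P _ I σ sch k i).2 h0, (run_eq_none_iff P _ I σ' sch' k i).2 (h ▸ h0)]
  induction k generalizing i with
  | zero =>
    simp only [run, startConfig] at h h0 ⊢
    split_ifs at h h0 ⊢ with h1 h2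
    · have hx : h1.choose = h2.choose := View.input.inj (Option.some.inj h)
      rw [hx]
    · simp at h0
  | succ k ih =>
    have ih' : ∀ j, run (fullInformation n V) I σ sch k j =
        run (fullInformation n V) I σ' sch' k j → run P I σ sch k j = run P I σ' sch' k j := by
      intro j hj
      by_cases hj0 : run (fullInformation n V) I σ sch k j = none
      · rw [(run_eq_none_iff P _ I σ sch k j).2 hj0,
          (run_eq_none_iff P _ I σ' sch' k j).2 (hj ▸ hj0)]
      · exact ih hj hj0
    obtain ⟨hA, hA', hv⟩ := view_eq_of_step_eq h h0
    have hi : run P I σ sch k i = run P I σ' sch' k i := ih' i (by simpa [hA, hA'] using hv i)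
    have hview : view P (k + 1) (run P I σ sch k) (sch k).1 (sch k).2 i =
        view P (k + 1) (run P I σ' sch' k) (sch' k).1 (sch' k).2 i := by
      funext j
      have hj := hv j
      simp only [view]
      split_ifs at hj ⊢
      · rw [ih' j hj]
      · rw [(run_eq_none_iff P _ I σ sch k j).2 hj, Option.map_none]
      · rw [(run_eq_none_iff P _ I σ' sch' k j).2 hj.symm, Option.map_none]
      · rfl
    simp only [run, step, hA, hA', if_true, hi, hview]

/-- If the protocol complex of `P` is isomorphic to the full-information complex, then the state
of a process in `P` determines its full-information view. Only the equality of the numbers of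
vertices is used. -/
theorem fullInformation_eq_of_run_eq {P : Protocol n V S E} {I : ChromaticComplex n V} {r : ℕ}
    (hI : I.faces.Finite)
    (hiso : Isomorphic (protocolComplex (fullInformation n V) I r) (protocolComplex P I r))
    {σ σ' : Finset V} (hσ : σ ∈ I.faces) (hσ' : σ' ∈ I.faces) {sch sch' : Schedule n} {i : Fin n}
    (h : run P I σ sch r i = run P I σ' sch' r i) :
    run (fullInformation n V) I σ sch r i = run (fullInformation n V) I σ' sch' r i := by
  set F := fullInformation n V
  obtain ⟨f, -⟩ := hiso
  have key : ∀ x : vertices (protocolComplex F I r), ∃ y : vertices (protocolComplex P I r),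
      ∀ σ ∈ I.faces, ∀ sch : Schedule n, run F I σ sch r x.1.1 = some x.1.2 →
        y.1.1 = x.1.1 ∧ run P I σ sch r x.1.1 = some y.1.2 := by
    rintro ⟨⟨j, w⟩, hx⟩
    obtain ⟨c, hc, hw⟩ := mem_vertices_protocolComplex.1 hx
    obtain ⟨τ, hτ, sch₀, rfl⟩ := hc.exists_run
    obtain ⟨s, hs⟩ := Option.ne_none_iff_exists'.1
      (mt (run_eq_none_iff P F I τ sch₀ r j).1 (by simp_all))
    refine ⟨⟨(j, s), mem_vertices_protocolComplex.2 ⟨_, reachable_run P I hτ sch₀ r, hs⟩⟩,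
      fun σ hσ sch hw' => ⟨rfl, ?_⟩⟩
    rw [← hs]
    exact run_eq_of_fullInformation_eq P I (hw'.trans hw.symm)
  choose g hg using key
  have hsurj : Function.Surjective g := by
    rintro ⟨⟨j, s⟩, hx⟩
    obtain ⟨c, hc, hs⟩ := mem_vertices_protocolComplex.1 hx
    obtain ⟨τ, hτ, sch₀, rfl⟩ := hc.exists_run
    obtain ⟨w, hw⟩ := Option.ne_none_iff_exists'.1
      (mt (run_eq_none_iff F P I τ sch₀ r j).1 (by simp_all))
    let x : vertices (protocolComplex F I r) :=
      ⟨(j, w), mem_vertices_protocolComplex.2 ⟨_, reachable_run F I hτ sch₀ r, hw⟩⟩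
    obtain ⟨h1, h2⟩ := hg x τ hτ sch₀ hw
    exact ⟨x, Subtype.ext (Prod.ext h1 (Option.some.inj (h2.symm.trans hs)))⟩
  have : Finite (vertices (protocolComplex F I r)) :=
    (finite_vertices_protocolComplex F hI r).to_subtype
  have hinj : Function.Injective g := by
    have := Finite.injective_iff_surjective.2 (f.symm.surjective.comp hsurj)
    exact this.of_comp
  by_cases h0 : run P I σ sch r i = none
  · rw [(run_eq_none_iff F P I σ sch r i).2 h0, (run_eq_none_iff F P I σ' sch' r i).2 (h ▸ h0)]
  obtain ⟨w, hw⟩ := Option.ne_none_iff_exists'.1 (mt (run_eq_none_iff F P I σ sch r i).1 h0)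
  obtain ⟨w', hw'⟩ := Option.ne_none_iff_exists'.1
    (mt (run_eq_none_iff F P I σ' sch' r i).1 (h ▸ h0))
  let x : vertices (protocolComplex F I r) :=
    ⟨(i, w), mem_vertices_protocolComplex.2 ⟨_, reachable_run F I hσ sch r, hw⟩⟩
  let x' : vertices (protocolComplex F I r) :=
    ⟨(i, w'), mem_vertices_protocolComplex.2 ⟨_, reachable_run F I hσ' sch' r, hw'⟩⟩
  obtain ⟨h1, h2⟩ := hg x σ hσ sch hw
  obtain ⟨h1', h2'⟩ := hg x' σ' hσ' sch' hw'
  have hxx : x = x' := hinj (Subtype.ext (Prod.ext (h1.trans h1'.symm)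
    (Option.some.inj (h2.symm.trans (h.trans h2')))))
  have hww : w = w' := congrArg (fun y => y.1.2) hxx
  rw [hw, hw', hww]

/-! ### Executions in which one process runs ahead alone -/

/-- The schedule in which, in each of the first `k` rounds, first `q` moves alone, then `p`
together with the processes in the set `T` prescribes for that round, then all others. In later
rounds just `p` and `q` take part, in one block. -/
def aheadSchedule (p q : Fin n) {k : ℕ} (T : Fin k → Finset (Fin n)) : Schedule n := fun t =>
  if h : t < k then
    (Finset.univ, fun j => if j = q then 0 else if j = p ∨ j ∈ T ⟨t, h⟩ then 1 else 2)
  else ({p, q}, 0)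

theorem startConfig_ne_none (P : Protocol n V S E) {I : ChromaticComplex n V} {σ : Finset V}
    (hσ : σ ∈ I.faces) (hcard : σ.card = n) (i : Fin n) : startConfig P I σ i ≠ none := by
  classical
  have himage : σ.image I.color = Finset.univ := by
    rw [← Finset.card_eq_iff_eq_univ, Finset.card_image_of_injOn (I.color_injOn σ hσ), hcard,
      Fintype.card_fin]
  obtain ⟨x, hx, hxi⟩ := Finset.mem_image.1 (himage ▸ Finset.mem_univ i)
  have h : ∃ x ∈ σ, I.color x = i := ⟨x, hx, hxi⟩
  simp [startConfig, h]

theorem run_aheadSchedule_ne_none (P : Protocol n V S E) {I : ChromaticComplex n V}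
    {σ : Finset V} (hσ : σ ∈ I.faces) (hcard : σ.card = n) (p q : Fin n) {k : ℕ}
    (T : Fin k → Finset (Fin n)) {t : ℕ} (ht : t ≤ k) (i : Fin n) :
    run P I σ (aheadSchedule p q T) t i ≠ none := by
  induction t with
  | zero => exact startConfig_ne_none P hσ hcard i
  | succ t ih =>
    have h := ih (Nat.le_of_succ_le ht)
    simpa [run, step, aheadSchedule, Nat.lt_of_succ_le ht] using h

/-- The process that runs ahead never notices the sets prescribed for the others. -/
theorem run_aheadSchedule_ahead (P : Protocol n V S E) (I : ChromaticComplex n V)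
    (σ : Finset V) (p q : Fin n) {k : ℕ} (T T' : Fin k → Finset (Fin n)) {t : ℕ} (ht : t ≤ k) :
    run P I σ (aheadSchedule p q T) t q = run P I σ (aheadSchedule p q T') t q := by
  induction t with
  | zero => rfl
  | succ t ih =>
    have h := ih (Nat.le_of_succ_le ht)
    have hview : ∀ T : Fin k → Finset (Fin n),
        view P (t + 1) (run P I σ (aheadSchedule p q T) t) (aheadSchedule p q T t).1
          (aheadSchedule p q T t).2 q =
        fun j => if j = q then
          (run P I σ (aheadSchedule p q T) t q).map (fun s => P.encode q s (t + 1)) else none := by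
      intro T
      funext j
      by_cases hj : j = q
      · subst hj
        simp [view, aheadSchedule, Nat.lt_of_succ_le ht]
      · simp only [view, aheadSchedule, Nat.lt_of_succ_le ht, hj, dite_true, if_false, if_true]
        rw [if_neg]
        split_ifs <;> simp
    simp only [run, step, hview, h]
    simp [aheadSchedule, Nat.lt_of_succ_le ht]

/-- The full-information view of `p` records which processes it saw in each round. -/
theorem eq_of_run_aheadSchedule_eq {I : ChromaticComplex n V} {σ : Finset V} (hσ : σ ∈ I.faces)
    (hcard : σ.card = n) {p q : Fin n} (hpq : p ≠ q) {k : ℕ} {T T' : Fin k → Finset (Fin n)}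
    {t : ℕ} (ht : t ≤ k)
    (h : run (fullInformation n V) I σ (aheadSchedule p q T) t p =
      run (fullInformation n V) I σ (aheadSchedule p q T') t p)
    {m : Fin k} (hm : (m : ℕ) < t) {j : Fin n} (hjp : j ≠ p) (hjq : j ≠ q) :
    j ∈ T m ↔ j ∈ T' m := by
  induction t with
  | zero => exact absurd hm (Nat.not_lt_zero _)
  | succ t ih =>
    have htk := Nat.lt_of_succ_le ht
    have hv := (view_eq_of_step_eq h
      (run_aheadSchedule_ne_none (fullInformation n V) hσ hcard p q T ht p)).2.2
    obtain hmt | hmt := Nat.lt_succ_iff_lt_or_eq.1 hm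
    · refine ih htk.le ?_ hmt
      simpa [aheadSchedule, htk] using hv p
    · have hj := hv j
      have h1 := run_aheadSchedule_ne_none (fullInformation n V) hσ hcard p q T htk.le j
      have h2 := run_aheadSchedule_ne_none (fullInformation n V) hσ hcard p q T' htk.le j
      have hmk : m = ⟨t, htk⟩ := Fin.ext hmt
      subst hmk
      simp only [aheadSchedule, htk, dite_true, hjp, hjq, hpq, if_false, false_or, true_or,
        if_true, Finset.mem_univ, true_and] at hj
      by_cases hT : j ∈ T ⟨t, htk⟩ <;> by_cases hT' : j ∈ T' ⟨t, htk⟩ <;> simp_all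

/-! ### The lower bound -/

theorem two_pow_le_ncard_encodingSet {P : Protocol n V S E} {I : ChromaticComplex n V} {k : ℕ}
    (hI : I.faces.Finite) {σ : Finset V} (hσ : σ ∈ I.faces) (hcard : σ.card = n)
    (hiso : Isomorphic (protocolComplex (fullInformation n V) I (k + 1))
      (protocolComplex P I (k + 1))) {p q : Fin n} (hpq : p ≠ q) :
    2 ^ ((n - 2) * k) ≤ (encodingSet P I (k + 1) p).ncard := by
  set F := fullInformation n V
  let U : Finset (Fin n) := {p, q}ᶜ
  have hU : U.card = n - 2 := by
    rw [Finset.card_compl, Finset.card_pair hpq, Fintype.card_fin]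
  let D : Finset (Fin k → Finset (Fin n)) := Fintype.piFinset fun _ => U.powerset
  have hD : D.card = 2 ^ ((n - 2) * k) := by
    simp [D, hU, pow_mul]
  have hsome : ∀ T : Fin k → Finset (Fin n), ∃ s, run P I σ (aheadSchedule p q T) k p = some s :=
    fun T => Option.ne_none_iff_exists'.1
      (run_aheadSchedule_ne_none P hσ hcard p q T le_rfl p)
  choose s hs using hsome
  rw [← hD, ← Set.ncard_coe_finset]
  refine Set.ncard_le_ncard_of_injOn (fun T => P.encode p (s T) (k + 1)) ?_ ?_
    (finite_encodingSet P hI _ p)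
  · intro T _
    exact ⟨_, s T, reachable_run P I hσ (aheadSchedule p q T) k, hs T, rfl⟩
  intro T hT T' hT' henc
  simp only at henc
  have hq := run_aheadSchedule_ahead P I σ p q T T' le_rfl
  -- Since `p` writes the same value in both executions, `q` reads the same in the last round.
  have hlast : run P I σ (aheadSchedule p q T) (k + 1) q =
      run P I σ (aheadSchedule p q T') (k + 1) q := by
    have hview : view P (k + 1) (run P I σ (aheadSchedule p q T) k) {p, q} 0 q =
        view P (k + 1) (run P I σ (aheadSchedule p q T') k) {p, q} 0 q := by
      funext j
      by_cases hjp : j = p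
      · subst hjp
        simp [view, hs, henc]
      by_cases hjq : j = q
      · subst hjq
        simp [view, hq]
      simp [view, hjp, hjq]
    have hsch : ∀ T : Fin k → Finset (Fin n), aheadSchedule p q T k = ({p, q}, 0) := fun T => by
      simp [aheadSchedule]
    simp only [run, step, hsch, hview, hq]
  have hfull := fullInformation_eq_of_run_eq hI hiso hσ hσ hlast
  have hne : run F I σ (aheadSchedule p q T) (k + 1) q ≠ none := by
    have := run_aheadSchedule_ne_none F hσ hcard p q T le_rfl q
    simpa [run, step, aheadSchedule] using this
  have hp : run F I σ (aheadSchedule p q T) k p = run F I σ (aheadSchedule p q T') k p := by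
    simpa [aheadSchedule] using (view_eq_of_step_eq hfull hne).2.2 p
  funext m
  have hTm : T m ⊆ U := Finset.mem_powerset.1 (Fintype.mem_piFinset.1 hT m)
  have hTm' : T' m ⊆ U := Finset.mem_powerset.1 (Fintype.mem_piFinset.1 hT' m)
  ext j
  by_cases hj : j ∈ U
  · obtain ⟨hjp, hjq⟩ : j ≠ p ∧ j ≠ q := by simpa [U] using hj
    exact eq_of_run_aheadSchedule_eq hσ hcard hpq le_rfl hp m.2 hjp hjq
  · exact iff_of_false (fun h => hj (hTm h)) fun h => hj (hTm' h)

end IIS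

theorem mainTheorem1 :
    ∃ C : ℝ, 0 < C ∧
      ∀ (n r : ℕ), 2 < n → 2 ≤ r →
      ∀ (V : Type u) (S : Type v) (E : Type w)
        (I : IIS.ChromaticComplex n V) (P : IIS.Protocol n V S E),
        I.faces.Finite → (∃ σ ∈ I.faces, σ.card = n) →
        IIS.Isomorphic (IIS.protocolComplex (IIS.fullInformation n V) I r)
          (IIS.protocolComplex P I r) →
        ∀ p : Fin n, C * ((r : ℝ) * (n : ℝ)) ≤ IIS.bitComplexity P I r p := by
  refine ⟨1 / 6, by norm_num, ?_⟩
  rintro n r hn hr V S E I P hI ⟨σ, hσ, hcard⟩ hiso p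
  obtain ⟨k, rfl⟩ : ∃ k, r = k + 1 := ⟨r - 1, by omega⟩
  have : Nontrivial (Fin n) := Fin.nontrivial_iff_two_le.2 hn.le
  obtain ⟨q, hq⟩ := exists_ne p
  have hcount := IIS.two_pow_le_ncard_encodingSet hI hσ hcard hiso hq.symm
  have hlog : (((n - 2) * k : ℕ) : ℝ) ≤ IIS.bitComplexity P I (k + 1) p := by
    unfold IIS.bitComplexity
    have hpos : (0 : ℝ) < 2 ^ ((n - 2) * k) := by positivity
    calc (((n - 2) * k : ℕ) : ℝ) = Real.logb 2 (2 ^ ((n - 2) * k)) := by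
          rw [Real.logb_pow, Real.logb_self_eq_one one_lt_two, mul_one]
      _ ≤ _ := Real.logb_le_logb_of_le one_lt_two hpos (by exact_mod_cast hcount)
  refine le_trans ?_ hlog
  have hn' : (3 : ℝ) ≤ n := by exact_mod_cast hn
  have hk : (1 : ℝ) ≤ k := by exact_mod_cast Nat.le_of_succ_le_succ hr
  push_cast [Nat.cast_sub hn.le]
  -- `n - 2 ≥ n / 3` and `k ≥ (k + 1) / 2`.
  nlinarith [mul_nonneg (sub_nonneg.2 hn') (sub_nonneg.2 hk)]
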